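/- Let $\Gamma$ be a (compact, connected) metric graph with a model $(G,l)$. For a metric graph $\Gamma'$ let $W_d^1(\Gamma')$ be the set of classes of divisors of degree $d$ and (Baker–Norine) rank at least $1$; call $\Gamma'$ \emph{divisorially trigonal} if $W_3^1(\Gamma')\neq\emptyset$ and \emph{hyperelliptic} if $W_2^1(\Gamma')\neq\emptyset$. A vertex of $G$ is \emph{separating} if $G$ is the union of two connected subgraphs, each with at least one edge, having only that vertex in common. Suppose that $\Gamma$ is a necklace: $G$ is the union of a cycle $\gamma$ and of $n\ge 3$ pairwise disjoint subgraphs $\Gamma_1,\dots,\Gamma_n$ such that, for each $i$, $\gamma\cap\Gamma_i=\{x_i\}$ is a separating vertex of $G$ (so the $\Gamma_i$ are the components of $\Gamma\setminus\gamma$, each together with the vertex $x_i$ at which it is glued to $\gamma$). Suppose that none of the $\Gamma_i$ is hyperelliptic and that $\Gamma$ is divisorially trigonal. Then $n=3$, each of the components $\Gamma_1,\Gamma_2,\Gamma_3$ is connected and divisorially trigonal, and $$d(x_1,x_2)=d(x_2,x_3)=d(x_1,x_3),$$ where $d$ is the path metric of $\Gamma$. -/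

import Mathlib

open Filter Topology

universe u v

/-- A model `(G, l)` of a metric graph: a finite multigraph (loops and multiple edges are allowed)
with positive edge lengths. Each edge carries a reference orientation, used only to parametrise it
by `[0, len e]`; nothing below depends on it. Connectedness is the separate predicate
`MetricGraph.Connected`. -/
structure MetricGraph where
  /-- the vertices -/
  V : Type u
  /-- the edges -/
  E : Type v
  finite_V : Finite V
  finite_E : Finite E
  /-- the origin of an edge -/
  src : E → V
  /-- the end of an edge -/
  tgt : E → V
  /-- the length of an edge -/
  len : E → ℝ
  len_pos : ∀ e, 0 < len e

namespace MetricGraph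

instance (Γ : MetricGraph.{u, v}) : Finite Γ.V := Γ.finite_V

instance (Γ : MetricGraph.{u, v}) : Finite Γ.E := Γ.finite_E

noncomputable instance (Γ : MetricGraph.{u, v}) : Fintype Γ.E := Fintype.ofFinite Γ.E

/-! ### Walks, connectedness, distances -/

/-- The edge `e` has endpoints `a` and `b` (which may coincide). -/
def Joins (Γ : MetricGraph.{u, v}) (e : Γ.E) (a b : Γ.V) : Prop :=
  (Γ.src e = a ∧ Γ.tgt e = b) ∨ (Γ.src e = b ∧ Γ.tgt e = a)

/-- Edge walks between vertices. -/
inductive Walk (Γ : MetricGraph.{u, v}) : Γ.V → Γ.V → Type (max u v)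
  | nil (a : Γ.V) : Walk Γ a a
  | cons {a b c : Γ.V} (e : Γ.E) (h : Γ.Joins e a b) (p : Walk Γ b c) : Walk Γ a c

/-- The total length of a walk. -/
def Walk.length {Γ : MetricGraph.{u, v}} : {a b : Γ.V} → Γ.Walk a b → ℝ
  | _, _, .nil _ => 0
  | _, _, .cons e _ p => Γ.len e + p.length

/-- The graph is non-empty and any two vertices are joined by a walk. -/
def Connected (Γ : MetricGraph.{u, v}) : Prop :=
  Nonempty Γ.V ∧ ∀ a b : Γ.V, Nonempty (Γ.Walk a b)

/-- The distance, in the path metric of the metric graph, between two vertices: the least total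
length of a walk between them. -/
noncomputable def dist (Γ : MetricGraph.{u, v}) (a b : Γ.V) : ℝ :=
  ⨅ p : Γ.Walk a b, p.length

/-! ### Points, divisors, rational functions -/

/-- The points of the metric graph: the vertices, and the interior points of the edges. -/
abbrev Point (Γ : MetricGraph.{u, v}) : Type (max u v) :=
  Γ.V ⊕ (Σ e : Γ.E, Set.Ioo (0 : ℝ) (Γ.len e))

open Classical in
/-- The point at distance `t` from the origin along the edge `e`, for `0 ≤ t ≤ len e`
(parameters outside of this interval are sent to the nearest endpoint). -/
noncomputable def pt (Γ : MetricGraph.{u, v}) (e : Γ.E) (t : ℝ) : Γ.Point :=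
  if h : 0 < t ∧ t < Γ.len e then Sum.inr ⟨e, t, h.1, h.2⟩
  else if t ≤ 0 then Sum.inl (Γ.src e) else Sum.inl (Γ.tgt e)

/-- Divisors: finitely supported integer combinations of points. Such a `D` is effective
if `0 ≤ D`. -/
abbrev Divisor (Γ : MetricGraph.{u, v}) : Type (max u v) := Γ.Point →₀ ℤ

/-- The degree of a divisor. -/
def deg (Γ : MetricGraph.{u, v}) (D : Γ.Divisor) : ℤ := D.sum fun _ n => n

/-- Near `pt e t`, in the direction `σ` (`1` for increasing and `-1` for decreasing parameter) of
the edge `e`, the function `f` is affine with outgoing slope `m`. -/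
def HasSlope (Γ : MetricGraph.{u, v}) (f : Γ.Point → ℝ) (e : Γ.E) (t σ : ℝ) (m : ℤ) : Prop :=
  ∀ᶠ h in 𝓝[>] (0 : ℝ), f (Γ.pt e (t + σ * h)) = f (Γ.pt e t) + m * h

/-- A rational function: at every point and in every direction it is affine near the point, with an
integer slope. As edges are compact intervals, this says exactly that `f` is continuous and
piecewise affine with finitely many pieces and integer slopes. -/
def IsRational (Γ : MetricGraph.{u, v}) (f : Γ.Point → ℝ) : Prop :=
  ∀ e : Γ.E, (∀ t ∈ Set.Ico 0 (Γ.len e), ∃ m, Γ.HasSlope f e t 1 m) ∧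
    ∀ t ∈ Set.Ioc 0 (Γ.len e), ∃ m, Γ.HasSlope f e t (-1) m

open Classical in
/-- The outgoing slope of `f` at `pt e t` in the direction `σ` of the edge `e`
(zero if there is none). -/
noncomputable def slope (Γ : MetricGraph.{u, v}) (f : Γ.Point → ℝ) (e : Γ.E) (t σ : ℝ) : ℤ :=
  if h : ∃ m, Γ.HasSlope f e t σ m then h.choose else 0

theorem HasSlope.slope_eq {Γ : MetricGraph.{u, v}} {f : Γ.Point → ℝ} {e : Γ.E} {t σ : ℝ} {m : ℤ}
    (hm : Γ.HasSlope f e t σ m) : Γ.slope f e t σ = m := by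
  have h : ∃ m, Γ.HasSlope f e t σ m := ⟨m, hm⟩
  have h1 : Γ.slope f e t σ = h.choose := by simp only [slope, dif_pos h]
  rw [h1]
  obtain ⟨x, ⟨hx1, hx2⟩, hx⟩ :=
    ((h.choose_spec.and hm).and (self_mem_nhdsWithin (a := (0 : ℝ)) (s := Set.Ioi 0))).exists
  have h2 : ((h.choose : ℤ) : ℝ) * x = (m : ℝ) * x := by linarith
  exact_mod_cast mul_right_cancel₀ (ne_of_gt hx) h2

open Classical in
/-- The principal divisor of `f`: at each point, the sum of the outgoing slopes over all directions
at that point (a loop at a vertex contributes two directions there). -/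
noncomputable def ord (Γ : MetricGraph.{u, v}) (f : Γ.Point → ℝ) : Γ.Point → ℤ
  | Sum.inl a => ∑ e : Γ.E, ((if Γ.src e = a then Γ.slope f e 0 1 else 0) +
      (if Γ.tgt e = a then Γ.slope f e (Γ.len e) (-1) else 0))
  | Sum.inr ⟨e, t⟩ => Γ.slope f e t 1 + Γ.slope f e t (-1)

/-- Linear equivalence of divisors: they differ by the divisor of a rational function. -/
def LinEquiv (Γ : MetricGraph.{u, v}) (D D' : Γ.Divisor) : Prop :=
  ∃ f : Γ.Point → ℝ, Γ.IsRational f ∧ ∀ p, D' p = D p + Γ.ord f p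

/-- The (Baker–Norine) rank of `D` is at least `r`: for every effective `E` of degree `r`, the
divisor `D - E` is linearly equivalent to an effective divisor. -/
def RankGE (Γ : MetricGraph.{u, v}) (D : Γ.Divisor) (r : ℕ) : Prop :=
  ∀ E : Γ.Divisor, 0 ≤ E → Γ.deg E = r → ∃ F : Γ.Divisor, 0 ≤ F ∧ Γ.LinEquiv (D - E) F

/-- The divisors of degree `d` and rank at least `r` (those whose classes form `W_d^r`). -/
def W (Γ : MetricGraph.{u, v}) (d r : ℕ) : Set Γ.Divisor :=
  {D | Γ.deg D = d ∧ Γ.RankGE D r}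

/-- Divisorially `d`-gonal: `W_d^1` is non-empty. -/
def DivisoriallyGonal (Γ : MetricGraph.{u, v}) (d : ℕ) : Prop := (Γ.W d 1).Nonempty

/-- Divisorially trigonal: there is a divisor of degree `3` and rank at least `1`. -/
def DivisoriallyTrigonal (Γ : MetricGraph.{u, v}) : Prop := Γ.DivisoriallyGonal 3

/-- Hyperelliptic: there is a divisor of degree `2` and rank at least `1`. -/
def Hyperelliptic (Γ : MetricGraph.{u, v}) : Prop := Γ.DivisoriallyGonal 2

/-! ### Subgraphs, cycles, separating vertices, necklaces -/

/-- A subgraph: sets of vertices and edges, containing the endpoints of its edges. -/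
structure Subgraph (Γ : MetricGraph.{u, v}) where
  /-- the vertices of the subgraph -/
  verts : Set Γ.V
  /-- the edges of the subgraph -/
  edges : Set Γ.E
  src_mem : ∀ e ∈ edges, Γ.src e ∈ verts
  tgt_mem : ∀ e ∈ edges, Γ.tgt e ∈ verts

/-- A subgraph, regarded as a metric graph with the same edge lengths. -/
def Subgraph.toMetricGraph {Γ : MetricGraph.{u, v}} (H : Γ.Subgraph) : MetricGraph.{u, v} where
  V := H.verts
  E := H.edges
  finite_V := inferInstance
  finite_E := inferInstance
  src e := ⟨Γ.src e, H.src_mem e e.2⟩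
  tgt e := ⟨Γ.tgt e, H.tgt_mem e e.2⟩
  len e := Γ.len e
  len_pos e := Γ.len_pos e

/-- The subgraph is a cycle: its vertices and its edges can be listed without repetition in cyclic
order (indices modulo `k + 1`), each edge joining consecutive vertices. -/
def Subgraph.IsCycle {Γ : MetricGraph.{u, v}} (H : Γ.Subgraph) : Prop :=
  ∃ (k : ℕ) (a : Fin (k + 1) → Γ.V) (e : Fin (k + 1) → Γ.E),
    Function.Injective a ∧ Function.Injective e ∧ Set.range a = H.verts ∧ Set.range e = H.edges ∧
      ∀ i, Γ.Joins (e i) (a i) (a (i + 1))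

/-- The vertex `a` is separating: the graph is the union of two connected subgraphs, each with at
least one edge, which have only the vertex `a` in common. -/
def IsSeparating (Γ : MetricGraph.{u, v}) (a : Γ.V) : Prop :=
  ∃ H K : Γ.Subgraph, H.toMetricGraph.Connected ∧ K.toMetricGraph.Connected ∧
    H.edges.Nonempty ∧ K.edges.Nonempty ∧
    H.verts ∪ K.verts = Set.univ ∧ H.edges ∪ K.edges = Set.univ ∧
    H.verts ∩ K.verts = {a} ∧ H.edges ∩ K.edges = ∅

/-- A necklace decomposition: a cycle `γ` in the graph and `n ≥ 3` pairwise disjoint subgraphs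
`Γ_1, …, Γ_n` (the components of the complement of `γ`, with their attaching points `x_i` added)
such that together they make up the whole graph and `Γ_i` meets `γ` exactly in the vertex `x_i`,
a separating vertex of the graph. -/
structure NecklaceDecomposition (Γ : MetricGraph.{u, v}) where
  /-- the number of subgraphs attached to the cycle -/
  n : ℕ
  three_le : 3 ≤ n
  /-- the cycle `γ` -/
  cycle : Γ.Subgraph
  isCycle : cycle.IsCycle
  /-- the subgraphs `Γ_i` attached to the cycle -/
  component : Fin n → Γ.Subgraph
  /-- the attaching vertices `x_i` -/
  x : Fin n → Γ.V
  verts_cover : cycle.verts ∪ ⋃ i, (component i).verts = Set.univ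
  edges_cover : cycle.edges ∪ ⋃ i, (component i).edges = Set.univ
  disjoint : ∀ i j, i ≠ j → Disjoint (component i).verts (component j).verts
  verts_inter : ∀ i, cycle.verts ∩ (component i).verts = {x i}
  edges_inter : ∀ i, cycle.edges ∩ (component i).edges = ∅
  separating : ∀ i, Γ.IsSeparating (x i)

end MetricGraph

namespace MetricGraph

variable {Γ : MetricGraph.{u, v}}

/-! ### Slopes along an edge -/

/-! Fix a divisor `D` of degree three and positive rank. Contracting the complement of a component
to its attaching point pushes divisors forward, and the push-forward of div f is the divisor of f
restricted to the component (`Retraction.push_eq_ord`). Degree, effectivity and linear equivalence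
therefore survive, so the image of `D` makes each component trigonal.

Non-hyperellipticity says that the image of `D` minus `x i` does not have positive rank: it has
degree two. So there is a point q of the component such that subtracting q as well leaves nothing
effective. An effective F equivalent to D - q then has no point over `x i`, hence lies inside the
component, and D is equivalent to F + q, which is supported there (`exists_linEquiv_component`).

Doing this in two components i and j gives a principal divisor that is seen from the cycle as 3x_i -
3x_j. On a circle of length L, Abel–Jacobi forces three times the difference of the positions to be
a multiple of L (`exists_three_mul_sub`). Distinct points congruent modulo L/3 number at most three
and are pairwise at circular distance L/3. This is also the distance in the whole graph, since the
components meet the cycle in one point each (`IsPosition.dist_eq`).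

All the divisor computations rest on one identity: pairing div f with a function is a sum over
edges, and an edge on which that function is constant contributes nothing (`edgeTerm_eq_zero`). -/

theorem HasSlope.eventually {f : Γ.Point → ℝ} {e : Γ.E} {t σ : ℝ} {m : ℤ}
    (hm : Γ.HasSlope f e t σ m) :
    ∀ᶠ h in 𝓝[>] (0 : ℝ), Γ.HasSlope f e (t + σ * h) σ m ∧
      Γ.HasSlope f e (t + σ * h) (-σ) (-m) := by
  obtain ⟨ε, hε, hs⟩ := mem_nhdsGT_iff_exists_Ioo_subset.1 hm
  have key : ∀ h ∈ Set.Ioo 0 ε, f (Γ.pt e (t + σ * h)) = f (Γ.pt e t) + m * h :=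
    fun h hh => hs hh
  filter_upwards [Ioo_mem_nhdsGT (Set.mem_Ioi.1 hε)] with h hh
  constructor
  · filter_upwards [Ioo_mem_nhdsGT (sub_pos.2 hh.2)] with h' hh'
    have h1 := key (h + h') ⟨by linarith [hh.1, hh'.1], by linarith [hh'.2]⟩
    rw [show t + σ * h + σ * h' = t + σ * (h + h') by ring, h1, key h hh]
    ring
  · filter_upwards [Ioo_mem_nhdsGT hh.1] with h' hh'
    have h1 := key (h - h') ⟨by linarith [hh'.2], by linarith [hh.2, hh'.1]⟩
    rw [show t + σ * h + -σ * h' = t + σ * (h - h') by ring, h1, key h hh]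
    push_cast
    ring

theorem tendsto_sub_nhdsGT_zero (t : ℝ) :
    Tendsto (fun t' => t' - t) (𝓝[>] t) (𝓝[>] 0) := by
  refine tendsto_nhdsWithin_iff.2 ⟨?_, ?_⟩
  · have : Tendsto (fun t' => t' - t) (𝓝 t) (𝓝 (t - t)) := tendsto_id.sub_const t
    rw [sub_self] at this
    exact this.mono_left nhdsWithin_le_nhds
  · filter_upwards [self_mem_nhdsWithin] with t' ht'
    exact sub_pos.2 (Set.mem_Ioi.1 ht')

theorem tendsto_const_sub_nhdsLT_zero (t : ℝ) :
    Tendsto (fun t' => t - t') (𝓝[<] t) (𝓝[>] 0) := by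
  refine tendsto_nhdsWithin_iff.2 ⟨?_, ?_⟩
  · have : Tendsto (fun t' => t - t') (𝓝 t) (𝓝 (t - t)) := tendsto_id.const_sub t
    rw [sub_self] at this
    exact this.mono_left nhdsWithin_le_nhds
  · filter_upwards [self_mem_nhdsWithin] with t' ht'
    exact sub_pos.2 (Set.mem_Iio.1 ht')

theorem HasSlope.eventually_right {f : Γ.Point → ℝ} {e : Γ.E} {t : ℝ} {m : ℤ}
    (hm : Γ.HasSlope f e t 1 m) :
    ∀ᶠ t' in 𝓝[>] t, Γ.slope f e t' 1 = m ∧ Γ.slope f e t' (-1) = -m := by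
  filter_upwards [(tendsto_sub_nhdsGT_zero t).eventually hm.eventually] with t' ht'
  rw [show t + 1 * (t' - t) = t' by ring] at ht'
  exact ⟨ht'.1.slope_eq, ht'.2.slope_eq⟩

theorem HasSlope.eventually_left {f : Γ.Point → ℝ} {e : Γ.E} {t : ℝ} {m : ℤ}
    (hm : Γ.HasSlope f e t (-1) m) :
    ∀ᶠ t' in 𝓝[<] t, Γ.slope f e t' 1 = -m := by
  filter_upwards [(tendsto_const_sub_nhdsLT_zero t).eventually hm.eventually] with t' ht'
  rw [show t + -1 * (t - t') = t' by ring, neg_neg] at ht'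
  exact ht'.2.slope_eq

theorem IsRational.hasSlope_right {f : Γ.Point → ℝ} (hf : Γ.IsRational f) (e : Γ.E) {t : ℝ}
    (ht : t ∈ Set.Ico 0 (Γ.len e)) : Γ.HasSlope f e t 1 (Γ.slope f e t 1) := by
  obtain ⟨m, hm⟩ := (hf e).1 t ht
  rwa [hm.slope_eq]

theorem IsRational.hasSlope_left {f : Γ.Point → ℝ} (hf : Γ.IsRational f) (e : Γ.E) {t : ℝ}
    (ht : t ∈ Set.Ioc 0 (Γ.len e)) : Γ.HasSlope f e t (-1) (Γ.slope f e t (-1)) := by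
  obtain ⟨m, hm⟩ := (hf e).2 t ht
  rwa [hm.slope_eq]

/-- The part of the finitely supported sum `S` at parameters at most `t`. -/
noncomputable def sumUpTo {l : ℝ} (S : Set.Ioo (0 : ℝ) l →₀ ℤ) (t : ℝ) : ℤ :=
  ∑ τ ∈ S.support, if (τ : ℝ) ≤ t then S τ else 0

theorem sumUpTo_eventually_right {l : ℝ} (S : Set.Ioo (0 : ℝ) l →₀ ℤ) (t : ℝ) :
    ∀ᶠ t' in 𝓝[>] t, sumUpTo S t' = sumUpTo S t := by
  have h : ∀ τ ∈ S.support, ∀ᶠ t' in 𝓝[>] t, ((τ : ℝ) ≤ t' ↔ (τ : ℝ) ≤ t) := by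
    intro τ _
    rcases le_or_gt (τ : ℝ) t with h | h
    · filter_upwards [self_mem_nhdsWithin] with t' ht'
      exact iff_of_true (h.trans (le_of_lt ht')) h
    · filter_upwards [Ioo_mem_nhdsGT h] with t' ht'
      exact iff_of_false (not_le.2 ht'.2) (not_le.2 h)
  filter_upwards [(Finset.eventually_all S.support).2 h] with t' ht'
  exact Finset.sum_congr rfl fun τ hτ => by simp only [ht' τ hτ]

theorem sumUpTo_eventually_left {l : ℝ} (S : Set.Ioo (0 : ℝ) l →₀ ℤ) (t : ℝ) :
    ∀ᶠ t' in 𝓝[<] t, sumUpTo S t' = ∑ τ ∈ S.support, if (τ : ℝ) < t then S τ else 0 := by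
  have h : ∀ τ ∈ S.support, ∀ᶠ t' in 𝓝[<] t, ((τ : ℝ) ≤ t' ↔ (τ : ℝ) < t) := by
    intro τ _
    rcases lt_or_ge (τ : ℝ) t with h | h
    · filter_upwards [Ioo_mem_nhdsLT h] with t' ht'
      exact iff_of_true ht'.1.le h
    · filter_upwards [self_mem_nhdsWithin] with t' ht'
      exact iff_of_false (not_le.2 (lt_of_lt_of_le ht' h)) (not_lt.2 h)
  filter_upwards [(Finset.eventually_all S.support).2 h] with t' ht'
  exact Finset.sum_congr rfl fun τ hτ => by simp only [ht' τ hτ]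

theorem sumUpTo_eq_add {l : ℝ} (S : Set.Ioo (0 : ℝ) l →₀ ℤ) (t : Set.Ioo (0 : ℝ) l) :
    sumUpTo S t = (∑ τ ∈ S.support, if (τ : ℝ) < t then S τ else 0) + S t := by
  have h : S t = ∑ τ ∈ S.support, if τ = t then S τ else 0 := by
    rw [Finset.sum_ite_eq']
    split_ifs with h
    · rfl
    · exact Finsupp.notMem_support_iff.1 h
  rw [h, sumUpTo, ← Finset.sum_add_distrib]
  refine Finset.sum_congr rfl fun τ _ => ?_
  rcases lt_trichotomy τ t with h | h | h
  · simp [h.ne, Subtype.coe_lt_coe.2 h, (Subtype.coe_lt_coe.2 h).le]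
  · simp [h]
  · simp [h.ne', not_le.2 (Subtype.coe_lt_coe.2 h), not_lt.2 (Subtype.coe_lt_coe.2 h).le]

/-- The right slope at `t` is the slope at the origin plus the bends passed. -/
theorem IsRational.slope_eq_add_sumUpTo {f : Γ.Point → ℝ} (hf : Γ.IsRational f) (e : Γ.E)
    (S : Set.Ioo (0 : ℝ) (Γ.len e) →₀ ℤ)
    (hS : ∀ t : Set.Ioo (0 : ℝ) (Γ.len e), S t = Γ.slope f e t 1 + Γ.slope f e t (-1))
    {t : ℝ} (ht : t ∈ Set.Ico 0 (Γ.len e)) :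
    Γ.slope f e t 1 = Γ.slope f e 0 1 + sumUpTo S t := by
  -- The difference is locally constant: a jump of the right slope at `s` is exactly the bend `S s`.
  -- Connectedness of the half-open interval makes it constant, and at 0 no bend has been passed.
  have hcont : ContinuousOn (fun t => Γ.slope f e t 1 - sumUpTo S t) (Set.Ico 0 (Γ.len e)) := by
    intro s hs
    have hr : ∀ᶠ t' in 𝓝[>] s, Γ.slope f e t' 1 - sumUpTo S t' =
        Γ.slope f e s 1 - sumUpTo S s := by
      filter_upwards [(hf.hasSlope_right e hs).eventually_right,
        sumUpTo_eventually_right S s] with t' h1 h2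
      rw [h1.1, h2]
    have hri : ∀ᶠ t' in 𝓝[≥] s, Γ.slope f e t' 1 - sumUpTo S t' =
        Γ.slope f e s 1 - sumUpTo S s := by
      rw [← Set.Ioi_insert, nhdsWithin_insert]
      exact eventually_sup.2 ⟨by simp, hr⟩
    refine tendsto_nhds_of_eventually_eq ?_
    rcases eq_or_lt_of_le hs.1 with h0 | h0
    · subst h0
      exact hri.filter_mono (nhdsWithin_mono _ Set.Ico_subset_Ici_self)
    · have hl : ∀ᶠ t' in 𝓝[<] s, Γ.slope f e t' 1 - sumUpTo S t' =
          Γ.slope f e s 1 - sumUpTo S s := by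
        filter_upwards [(hf.hasSlope_left e ⟨h0, hs.2.le⟩).eventually_left,
          sumUpTo_eventually_left S s] with t' h1 h2
        rw [h1, h2, sumUpTo_eq_add S ⟨s, h0, hs.2⟩, hS]
        ring
      refine Eventually.filter_mono nhdsWithin_le_nhds ?_
      rw [← nhdsLT_sup_nhdsGE]
      exact eventually_sup.2 ⟨hl, hri⟩
  have h := isPreconnected_Ico.constant hcont ht
    (Set.left_mem_Ico.2 (Γ.len_pos e))
  have h0 : sumUpTo S 0 = 0 :=
    Finset.sum_eq_zero fun τ _ => if_neg (not_le.2 τ.2.1)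
  simp only [h0] at h
  linarith

/-- The slopes at the ends of an edge and the bends in its interior add up to zero. -/
theorem IsRational.slope_add_slope_add_sum {f : Γ.Point → ℝ} (hf : Γ.IsRational f) (e : Γ.E)
    (S : Set.Ioo (0 : ℝ) (Γ.len e) →₀ ℤ)
    (hS : ∀ t : Set.Ioo (0 : ℝ) (Γ.len e), S t = Γ.slope f e t 1 + Γ.slope f e t (-1)) :
    Γ.slope f e 0 1 + Γ.slope f e (Γ.len e) (-1) + S.sum (fun _ n => n) = 0 := by
  have hl := Γ.len_pos e
  -- A parameter just before the end of the edge: all bends are already passed, and the right slope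
  -- there is minus the outgoing slope at the end.
  obtain ⟨t, ⟨h1, h2⟩, h3⟩ :=
    (((hf.hasSlope_left e ⟨hl, le_rfl⟩).eventually_left.and
      (sumUpTo_eventually_left S (Γ.len e))).and (Ioo_mem_nhdsLT hl)).exists
  have h4 := hf.slope_eq_add_sumUpTo e S hS ⟨h3.1.le, h3.2⟩
  have h5 : S.sum (fun _ n => n) =
      ∑ τ ∈ S.support, if (τ : ℝ) < Γ.len e then S τ else 0 :=
    Finset.sum_congr rfl fun τ _ => (if_pos τ.2.2).symm
  rw [h5, ← h2]
  linarith

/-! ### Integrating the slope along an edge without bends. -/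

theorem hasDerivWithinAt_Ici_of_hasSlope {g : ℝ → ℝ} {t : ℝ} {m : ℤ}
    (h : ∀ᶠ h in 𝓝[>] (0 : ℝ), g (t + 1 * h) = g t + m * h) :
    HasDerivWithinAt g m (Set.Ici t) t := by
  have h2 : HasDerivWithinAt (fun t' => g t + m * (t' - t)) m (Set.Ioi t) t := by
    simpa using ((((hasDerivAt_id t).sub_const t).const_mul (m : ℝ)).const_add
      (g t)).hasDerivWithinAt (s := Set.Ioi t)
  rw [← hasDerivWithinAt_Ioi_iff_Ici]
  refine h2.congr_of_eventuallyEq ?_ (by simp)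
  filter_upwards [(tendsto_sub_nhdsGT_zero t).eventually h] with t' ht'
  rw [← ht']
  congr 1
  ring

theorem continuousWithinAt_Iic_of_hasSlope {g : ℝ → ℝ} {t : ℝ} {m : ℤ}
    (h : ∀ᶠ h in 𝓝[>] (0 : ℝ), g (t + -1 * h) = g t + m * h) :
    ContinuousWithinAt g (Set.Iic t) t := by
  have h2 : ContinuousWithinAt (fun t' => g t + m * (t - t')) (Set.Iio t) t := by fun_prop
  rw [← continuousWithinAt_Iio_iff_Iic]
  refine h2.congr_of_eventuallyEq ?_ (by simp)
  filter_upwards [(tendsto_const_sub_nhdsLT_zero t).eventually h] with t' ht'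
  rw [← ht']
  congr 1
  ring

theorem pt_zero (e : Γ.E) : Γ.pt e 0 = Sum.inl (Γ.src e) := by simp [pt]

theorem pt_len (e : Γ.E) : Γ.pt e (Γ.len e) = Sum.inl (Γ.tgt e) := by
  simp [pt, not_le.2 (Γ.len_pos e)]

/-- Without bends the right slope is the constant `m`, so f - m t is continuous with zero right
derivative, hence constant. -/
theorem IsRational.sub_eq_slope_mul {f : Γ.Point → ℝ} (hf : Γ.IsRational f) (e : Γ.E)
    (hS : ∀ t : Set.Ioo (0 : ℝ) (Γ.len e), Γ.slope f e t 1 + Γ.slope f e t (-1) = 0) :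
    f (Sum.inl (Γ.tgt e)) - f (Sum.inl (Γ.src e)) = Γ.slope f e 0 1 * Γ.len e := by
  have hl := Γ.len_pos e
  set m := Γ.slope f e 0 1 with hm
  have hslope : ∀ t ∈ Set.Ico 0 (Γ.len e), Γ.HasSlope f e t 1 m := by
    intro t ht
    have h := hf.slope_eq_add_sumUpTo e 0 (fun t => (hS t).symm) ht
    have h' := hf.hasSlope_right e ht
    rw [h] at h'
    simpa [sumUpTo] using h'
  have hder : ∀ t ∈ Set.Ico 0 (Γ.len e),
      HasDerivWithinAt (fun t => f (Γ.pt e t)) m (Set.Ici t) t := fun t ht =>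
    hasDerivWithinAt_Ici_of_hasSlope (g := fun t => f (Γ.pt e t)) (hslope t ht)
  have hcont : ContinuousOn (fun t => f (Γ.pt e t)) (Set.Icc 0 (Γ.len e)) := by
    intro t ht
    have hr : t < Γ.len e → ContinuousWithinAt (fun t => f (Γ.pt e t)) (Set.Ici t) t :=
      fun h => (hder t ⟨ht.1, h⟩).continuousWithinAt
    have hle : 0 < t → ContinuousWithinAt (fun t => f (Γ.pt e t)) (Set.Iic t) t := fun h =>
      continuousWithinAt_Iic_of_hasSlope (g := fun t => f (Γ.pt e t))
        (hf.hasSlope_left e ⟨h, ht.2⟩)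
    rcases eq_or_lt_of_le ht.1 with h0 | h0
    · subst h0
      exact (hr hl).mono Set.Icc_subset_Ici_self
    · rcases eq_or_lt_of_le ht.2 with h1 | h1
      · subst h1
        exact (hle h0).mono Set.Icc_subset_Iic_self
      · have := (hle h0).union (hr h1)
        rw [Set.Iic_union_Ici] at this
        exact this.mono (Set.subset_univ _)
  have h := constant_of_has_deriv_right_zero (f := fun t => f (Γ.pt e t) - m * t)
    (hcont.sub (by fun_prop)) (fun t ht => by
      have h := (hder t ht).sub ((hasDerivAt_id t).const_mul (m : ℝ)).hasDerivWithinAt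
      rw [mul_one, sub_self] at h
      exact h)
    (Γ.len e) (Set.right_mem_Icc.2 hl.le)
  simp only [pt_zero, pt_len, mul_zero, sub_zero] at h
  linarith

/-! ### Pairing principal divisors with functions on the points -/

theorem interior_injective (e : Γ.E) : Function.Injective
    (fun t : Set.Ioo (0 : ℝ) (Γ.len e) => (Sum.inr ⟨e, t⟩ : Γ.Point)) := by
  intro s t h
  simpa using h

/-- The restriction of a divisor to the interior of an edge. -/
noncomputable def bends (G : Γ.Divisor) (e : Γ.E) : Set.Ioo (0 : ℝ) (Γ.len e) →₀ ℤ :=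
  G.comapDomain (fun t => Sum.inr ⟨e, t⟩) (interior_injective e).injOn

theorem bends_apply (G : Γ.Divisor) (e : Γ.E) (t : Set.Ioo (0 : ℝ) (Γ.len e)) :
    bends G e t = G (Sum.inr ⟨e, t⟩) := rfl

/-- The contribution of a closed edge to the pairing of the principal divisor `G` of `f`
with `Ψ`. -/
noncomputable def edgeTerm {A : Type*} [AddCommGroup A] (f : Γ.Point → ℝ) (G : Γ.Divisor)
    (Ψ : Γ.Point → A) (e : Γ.E) : A :=
  Γ.slope f e 0 1 • Ψ (Sum.inl (Γ.src e)) + Γ.slope f e (Γ.len e) (-1) • Ψ (Sum.inl (Γ.tgt e)) +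
    (bends G e).sum fun t n => n • Ψ (Sum.inr ⟨e, t⟩)

/-- At a vertex, `ord` adds the end slopes of the incident edges. Regrouping by edge leaves for each
edge its two end slopes and its interior bends; a loop contributes both end slopes to one vertex. -/
theorem divisor_eq_sum_edges {f : Γ.Point → ℝ} {G : Γ.Divisor} (hG : ∀ p, G p = Γ.ord f p) :
    G = ∑ e, (Finsupp.single (Sum.inl (Γ.src e)) (Γ.slope f e 0 1) +
      Finsupp.single (Sum.inl (Γ.tgt e)) (Γ.slope f e (Γ.len e) (-1)) +
      (bends G e).mapDomain fun t => Sum.inr ⟨e, t⟩) := by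
  classical
  ext p
  rw [Finsupp.finsetSum_apply]
  rcases p with a | ⟨e, t⟩
  · rw [hG, ord]
    refine Finset.sum_congr rfl fun e _ => ?_
    rw [Finsupp.add_apply, Finsupp.add_apply, Finsupp.single_apply, Finsupp.single_apply,
      Finsupp.mapDomain_of_notMem_range _ _ (by simp)]
    simp
  · rw [Finset.sum_eq_single e]
    · rw [Finsupp.add_apply, Finsupp.add_apply, Finsupp.single_apply, Finsupp.single_apply,
        Finsupp.mapDomain_apply (interior_injective e) (bends G e) t]
      simp [bends_apply]
    · intro e' _ he
      rw [Finsupp.add_apply, Finsupp.add_apply, Finsupp.single_apply, Finsupp.single_apply,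
        Finsupp.mapDomain_of_notMem_range]
      · simp
      · rintro ⟨s, hs⟩
        simp only [Sum.inr.injEq, Sigma.mk.injEq] at hs
        exact he hs.1
    · simp

theorem linearCombination_eq_sum_edgeTerm {A : Type*} [AddCommGroup A] {f : Γ.Point → ℝ}
    {G : Γ.Divisor} (hG : ∀ p, G p = Γ.ord f p) (Ψ : Γ.Point → A) :
    Finsupp.linearCombination ℤ Ψ G = ∑ e, edgeTerm f G Ψ e := by
  conv_lhs => rw [divisor_eq_sum_edges hG]
  rw [map_sum]
  refine Finset.sum_congr rfl fun e _ => ?_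
  rw [map_add, map_add, Finsupp.linearCombination_single, Finsupp.linearCombination_single,
    Finsupp.linearCombination_mapDomain]
  rfl

/-- The coefficients on a closed edge are its end slopes and bends, which add up to zero. This
yields that principal divisors have degree zero and that contracted edges do not count in
push-forwards or in the Abel–Jacobi sum. -/
theorem edgeTerm_eq_zero {A : Type*} [AddCommGroup A] {f : Γ.Point → ℝ} (hf : Γ.IsRational f)
    {G : Γ.Divisor} (hG : ∀ p, G p = Γ.ord f p) {Ψ : Γ.Point → A} {e : Γ.E} {c : A}
    (hs : Ψ (Sum.inl (Γ.src e)) = c) (ht : Ψ (Sum.inl (Γ.tgt e)) = c)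
    (hi : ∀ t, Ψ (Sum.inr ⟨e, t⟩) = c) : edgeTerm f G Ψ e = 0 := by
  have h := hf.slope_add_slope_add_sum e (bends G e) fun t => hG _
  rw [edgeTerm, hs, ht]
  simp only [hi]
  rw [Finsupp.sum, ← Finset.sum_smul, ← add_smul, ← add_smul]
  rw [Finsupp.sum] at h
  rw [h, zero_smul]

theorem deg_eq_linearCombination (G : Γ.Divisor) :
    Γ.deg G = Finsupp.linearCombination ℤ (fun _ => (1 : ℤ)) G := by
  simp [deg, Finsupp.linearCombination_apply]

theorem deg_sub (D D' : Γ.Divisor) : Γ.deg (D - D') = Γ.deg D - Γ.deg D' := by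
  simp [deg_eq_linearCombination]

theorem deg_single (p : Γ.Point) (n : ℤ) : Γ.deg (Finsupp.single p n) = n := by
  simp [deg_eq_linearCombination]

/-- Principal divisors have degree zero. -/
theorem LinEquiv.deg_eq {D D' : Γ.Divisor} (h : Γ.LinEquiv D D') : Γ.deg D' = Γ.deg D := by
  obtain ⟨f, hf, hD⟩ := h
  have hG : ∀ p, (D' - D) p = Γ.ord f p := fun p => by
    rw [Finsupp.sub_apply, hD]
    ring
  have h := linearCombination_eq_sum_edgeTerm hG (fun _ => (1 : ℤ))
  rw [Finset.sum_eq_zero fun e _ => edgeTerm_eq_zero hf hG rfl rfl fun _ => rfl,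
    ← deg_eq_linearCombination, deg_sub] at h
  linarith

/-! ### Linear equivalence -/

theorem HasSlope.sub {f g : Γ.Point → ℝ} {e : Γ.E} {t σ : ℝ} {m n : ℤ}
    (hf : Γ.HasSlope f e t σ m) (hg : Γ.HasSlope g e t σ n) :
    Γ.HasSlope (fun p => f p - g p) e t σ (m - n) := by
  filter_upwards [hf, hg] with h h1 h2
  rw [h1, h2]
  push_cast
  ring

theorem IsRational.sub {f g : Γ.Point → ℝ} (hf : Γ.IsRational f) (hg : Γ.IsRational g) :
    Γ.IsRational fun p => f p - g p := fun e =>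
  ⟨fun _ ht => ⟨_, (hf.hasSlope_right e ht).sub (hg.hasSlope_right e ht)⟩,
    fun _ ht => ⟨_, (hf.hasSlope_left e ht).sub (hg.hasSlope_left e ht)⟩⟩

theorem IsRational.ord_sub {f g : Γ.Point → ℝ} (hf : Γ.IsRational f) (hg : Γ.IsRational g)
    (p : Γ.Point) : Γ.ord (fun p => f p - g p) p = Γ.ord f p - Γ.ord g p := by
  have hr : ∀ e, ∀ t ∈ Set.Ico 0 (Γ.len e),
      Γ.slope (fun p => f p - g p) e t 1 = Γ.slope f e t 1 - Γ.slope g e t 1 :=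
    fun e t ht => ((hf.hasSlope_right e ht).sub (hg.hasSlope_right e ht)).slope_eq
  have hl : ∀ e, ∀ t ∈ Set.Ioc 0 (Γ.len e),
      Γ.slope (fun p => f p - g p) e t (-1) = Γ.slope f e t (-1) - Γ.slope g e t (-1) :=
    fun e t ht => ((hf.hasSlope_left e ht).sub (hg.hasSlope_left e ht)).slope_eq
  rcases p with a | ⟨e, t⟩
  · simp only [ord]
    rw [← Finset.sum_sub_distrib]
    refine Finset.sum_congr rfl fun e _ => ?_
    rw [hr e 0 ⟨le_rfl, Γ.len_pos e⟩, hl e _ ⟨Γ.len_pos e, le_rfl⟩]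
    split_ifs <;> ring
  · simp only [ord]
    rw [hr e t ⟨t.2.1.le, t.2.2⟩, hl e t ⟨t.2.1, t.2.2.le⟩]
    ring

theorem exists_eq_single {D : Γ.Divisor} (h0 : 0 ≤ D) (h1 : Γ.deg D = 1) :
    ∃ p, D = Finsupp.single p 1 := by
  have hne : D ≠ 0 := by
    rintro rfl
    simp [deg] at h1
  obtain ⟨p, hp⟩ := Finsupp.support_nonempty_iff.2 hne
  have hp1 : 1 ≤ D p := lt_of_le_of_ne (h0 p) (Finsupp.mem_support_iff.1 hp).symm
  have hle : Finsupp.single p 1 ≤ D := by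
    classical
    intro q
    rw [Finsupp.single_apply]
    split_ifs with h
    · exact h ▸ hp1
    · exact h0 q
  refine ⟨p, ?_⟩
  have hd : Γ.deg (D - Finsupp.single p 1) = 0 := by rw [deg_sub, deg_single, h1, sub_self]
  have hz : ∀ q ∈ (D - Finsupp.single p 1).support, (D - Finsupp.single p 1 : Γ.Divisor) q = 0 :=
    (Finset.sum_eq_zero_iff_of_nonneg fun q _ => sub_nonneg.2 (hle q)).1 hd
  have : D - Finsupp.single p 1 = 0 := by
    ext q
    by_cases hq : q ∈ (D - Finsupp.single p 1).support
    · exact hz q hq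
    · exact Finsupp.notMem_support_iff.1 hq
  exact sub_eq_zero.1 this

theorem rankGE_one_iff {D : Γ.Divisor} : Γ.RankGE D 1 ↔
    ∀ p, ∃ F : Γ.Divisor, 0 ≤ F ∧ Γ.LinEquiv (D - Finsupp.single p 1) F := by
  constructor
  · intro h p
    exact h _ (Finsupp.single_nonneg.2 zero_le_one) (by simp [deg_single])
  · intro h E hE hd
    obtain ⟨p, rfl⟩ := exists_eq_single hE (by simpa using hd)
    exact h p

/-! ### Retractions onto subgraphs -/

/-- The inclusion of the points of a subgraph. -/
def Subgraph.incl (H : Γ.Subgraph) : H.toMetricGraph.Point → Γ.Point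
  | Sum.inl a => Sum.inl a.1
  | Sum.inr ⟨e, t⟩ => Sum.inr ⟨e.1, t⟩

theorem Subgraph.incl_pt (H : Γ.Subgraph) (e : H.toMetricGraph.E) (t : ℝ) :
    H.incl (H.toMetricGraph.pt e t) = Γ.pt e.1 t := by
  unfold pt
  have h : H.toMetricGraph.len e = Γ.len e.1 := rfl
  simp only [h]
  split_ifs <;> rfl

theorem Subgraph.hasSlope_comp_incl (H : Γ.Subgraph) (f : Γ.Point → ℝ) (e : H.toMetricGraph.E)
    (t σ : ℝ) (m : ℤ) :
    H.toMetricGraph.HasSlope (f ∘ H.incl) e t σ m ↔ Γ.HasSlope f e.1 t σ m := by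
  simp only [HasSlope, Function.comp_apply, H.incl_pt]

theorem Subgraph.slope_comp_incl (H : Γ.Subgraph) (f : Γ.Point → ℝ) (e : H.toMetricGraph.E)
    (t σ : ℝ) : H.toMetricGraph.slope (f ∘ H.incl) e t σ = Γ.slope f e.1 t σ := by
  by_cases h : ∃ m, Γ.HasSlope f e.1 t σ m
  · obtain ⟨m, hm⟩ := h
    rw [hm.slope_eq, ((H.hasSlope_comp_incl f e t σ m).2 hm).slope_eq]
  · rw [slope, slope, dif_neg h, dif_neg]
    simpa only [H.hasSlope_comp_incl] using h

theorem Subgraph.isRational_comp_incl (H : Γ.Subgraph) {f : Γ.Point → ℝ} (hf : Γ.IsRational f) :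
    H.toMetricGraph.IsRational (f ∘ H.incl) := by
  intro e
  simp only [H.hasSlope_comp_incl]
  exact hf e.1

/-- A map from the vertices to those of a subgraph, which fixes the latter and contracts each edge
outside of the subgraph to a vertex. -/
structure Retraction (H : Γ.Subgraph) where
  toFun : Γ.V → H.verts
  apply_of_mem : ∀ a : H.verts, toFun a = a
  src_eq_tgt : ∀ e ∉ H.edges, toFun (Γ.src e) = toFun (Γ.tgt e)

namespace Retraction

variable {H : Γ.Subgraph} (r : Retraction H)

open Classical in
/-- The map on points defined by a retraction. -/
noncomputable def point : Γ.Point → H.toMetricGraph.Point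
  | Sum.inl a => Sum.inl (r.toFun a)
  | Sum.inr ⟨e, t⟩ => if h : e ∈ H.edges then Sum.inr ⟨⟨e, h⟩, t⟩ else Sum.inl (r.toFun (Γ.src e))

theorem point_inr_of_mem {e : Γ.E} (h : e ∈ H.edges) (t : Set.Ioo (0 : ℝ) (Γ.len e)) :
    r.point (Sum.inr ⟨e, t⟩) = Sum.inr ⟨⟨e, h⟩, t⟩ := dif_pos h

theorem point_inr_of_notMem {e : Γ.E} (h : e ∉ H.edges) (t : Set.Ioo (0 : ℝ) (Γ.len e)) :
    r.point (Sum.inr ⟨e, t⟩) = Sum.inl (r.toFun (Γ.src e)) := dif_neg h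

theorem point_incl (q : H.toMetricGraph.Point) : r.point (H.incl q) = q := by
  rcases q with a | ⟨e, t⟩
  · exact congrArg Sum.inl (r.apply_of_mem a)
  · exact r.point_inr_of_mem e.2 t

/-- The push-forward of a divisor along a retraction. -/
noncomputable def push (D : Γ.Divisor) : H.toMetricGraph.Divisor := D.mapDomain r.point

theorem push_sub (D D' : Γ.Divisor) : r.push (D - D') = r.push D - r.push D' :=
  map_sub (Finsupp.mapDomain.addMonoidHom r.point) D D'

theorem push_single_incl (q : H.toMetricGraph.Point) (n : ℤ) :
    r.push (Finsupp.single (H.incl q) n) = Finsupp.single q n := by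
  rw [push, Finsupp.mapDomain_single, r.point_incl]

theorem deg_push (D : Γ.Divisor) : H.toMetricGraph.deg (r.push D) = Γ.deg D :=
  Finsupp.sum_mapDomain_index (fun _ => rfl) fun _ _ _ => rfl

/-- Written as a pairing with the indicator of a fibre, a coefficient of the push-forward can be
computed edge by edge. -/
theorem push_apply [DecidableEq H.toMetricGraph.Point] (D : Γ.Divisor)
    (q : H.toMetricGraph.Point) :
    r.push D q = Finsupp.linearCombination ℤ (fun p => if r.point p = q then (1 : ℤ) else 0) D := by
  rw [push, Finsupp.mapDomain, Finsupp.sum_apply, Finsupp.linearCombination_apply]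
  refine Finset.sum_congr rfl fun p _ => ?_
  simp [Finsupp.single_apply]

theorem push_nonneg {D : Γ.Divisor} (hD : 0 ≤ D) : 0 ≤ r.push D := by
  classical
  intro q
  rw [push_apply, Finsupp.linearCombination_apply]
  refine Finset.sum_nonneg fun p _ => ?_
  simp only [smul_eq_mul, mul_ite, mul_one, mul_zero]
  split_ifs
  · exact hD p
  · exact le_rfl

/-- Effectivity rules out cancellation among the points of a fibre. -/
theorem point_ne_of_push_eq_zero {D : Γ.Divisor} (hD : 0 ≤ D) {q : H.toMetricGraph.Point}
    (hq : r.push D q = 0) {p : Γ.Point} (hp : p ∈ D.support) : r.point p ≠ q := by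
  classical
  rintro rfl
  rw [push_apply, Finsupp.linearCombination_apply, Finsupp.sum,
    Finset.sum_eq_zero_iff_of_nonneg] at hq
  · simpa using (Finsupp.mem_support_iff.1 hp) (by simpa using hq p hp)
  · intro p _
    simp only [smul_eq_mul, mul_ite, mul_one, mul_zero]
    split_ifs
    · exact hD p
    · exact le_rfl

/-- The push-forward of a principal divisor is the divisor of the restricted function. -/
theorem push_eq_ord {f : Γ.Point → ℝ} (hf : Γ.IsRational f) {G : Γ.Divisor}
    (hG : ∀ p, G p = Γ.ord f p) (q : H.toMetricGraph.Point) :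
    r.push G q = H.toMetricGraph.ord (f ∘ H.incl) q := by
  classical
  rcases q with a | ⟨e, t⟩
  · rw [push_apply, linearCombination_eq_sum_edgeTerm hG, ord]
    symm
    refine Fintype.sum_of_injective (fun e : H.toMetricGraph.E => e.1)
      Subtype.val_injective _ _ ?_ ?_
    -- An edge outside `H` is contracted, so the indicator of the fibre is constant along it.
    · intro e he
      have he : e ∉ H.edges := fun h => he ⟨⟨e, h⟩, rfl⟩
      refine edgeTerm_eq_zero hf hG rfl ?_ ?_
      · have h : r.point (Sum.inl (Γ.tgt e)) = r.point (Sum.inl (Γ.src e)) :=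
          congrArg Sum.inl (r.src_eq_tgt e he).symm
        exact congrArg (fun p => if p = Sum.inl a then (1 : ℤ) else 0) h
      · intro t
        rw [r.point_inr_of_notMem he]
        rfl
    -- On an edge of `H` no interior point lies over a vertex, so only the end slopes remain.
    · intro e
      have hs : r.point (Sum.inl (Γ.src e.1)) = Sum.inl (H.toMetricGraph.src e) :=
        r.point_incl (Sum.inl (H.toMetricGraph.src e))
      have ht : r.point (Sum.inl (Γ.tgt e.1)) = Sum.inl (H.toMetricGraph.tgt e) :=
        r.point_incl (Sum.inl (H.toMetricGraph.tgt e))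
      have hi : ∀ t, r.point (Sum.inr ⟨e.1, t⟩) ≠ Sum.inl a := by
        intro t
        rw [r.point_inr_of_mem e.2]
        exact Sum.inr_ne_inl
      rw [H.slope_comp_incl, H.slope_comp_incl, edgeTerm, hs, ht]
      simp only [hi, if_false, Finsupp.sum, Finset.sum_const_zero, add_zero,
        Sum.inl.injEq, smul_eq_mul, mul_ite, mul_one, mul_zero]
      rfl
  -- The fibre over an interior point of an edge of `H` is a single point.
  · have h : ∀ p, r.point p = Sum.inr ⟨e, t⟩ ↔ p = Sum.inr ⟨e.1, t⟩ := by
      intro p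
      constructor
      · intro hp
        rcases p with b | ⟨e', s⟩
        · exact absurd hp Sum.inl_ne_inr
        · by_cases he' : e' ∈ H.edges
          · rw [r.point_inr_of_mem he'] at hp
            exact congrArg H.incl hp
          · rw [r.point_inr_of_notMem he'] at hp
            exact absurd hp Sum.inl_ne_inr
      · rintro rfl
        exact r.point_inr_of_mem e.2 t
    have h1 : r.push G (Sum.inr ⟨e, t⟩) = G (Sum.inr ⟨e.1, t⟩) := by
      rw [push_apply, Finsupp.linearCombination_apply]
      simp only [h, smul_eq_mul, mul_ite, mul_one, mul_zero, Finsupp.sum_ite_eq']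
      split_ifs with h0
      · rfl
      · exact (Finsupp.notMem_support_iff.1 h0).symm
    rw [h1, hG]
    simp only [ord, H.slope_comp_incl]

theorem push_linEquiv {D D' : Γ.Divisor} (h : Γ.LinEquiv D D') :
    H.toMetricGraph.LinEquiv (r.push D) (r.push D') := by
  obtain ⟨f, hf, hD⟩ := h
  refine ⟨f ∘ H.incl, H.isRational_comp_incl hf, fun q => ?_⟩
  have hG : ∀ p, (D' - D) p = Γ.ord f p := fun p => by
    rw [Finsupp.sub_apply, hD]
    ring
  rw [← r.push_eq_ord hf hG, push_sub, Finsupp.sub_apply]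
  ring

theorem rankGE_one_push {D : Γ.Divisor} (hD : Γ.RankGE D 1) :
    H.toMetricGraph.RankGE (r.push D) 1 := by
  rw [rankGE_one_iff] at hD ⊢
  intro q
  obtain ⟨F, hF, h⟩ := hD (H.incl q)
  refine ⟨r.push F, r.push_nonneg hF, ?_⟩
  rw [← r.push_single_incl q, ← push_sub]
  exact r.push_linEquiv h

/-- If no divisor of degree `d` on the subgraph has positive rank, then a divisor of degree `d + 1`
and positive rank is equivalent to an effective one, `F + p`, supported on the subgraph, with `F`
away from a given vertex. -/
theorem exists_effective_away {d : ℕ} (hd : ¬ H.toMetricGraph.DivisoriallyGonal d)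
    {D : Γ.Divisor} (hdeg : Γ.deg D = d + 1) (hD : Γ.RankGE D 1) (x : H.toMetricGraph.Point) :
    ∃ (q : H.toMetricGraph.Point) (F : Γ.Divisor), 0 ≤ F ∧
      Γ.LinEquiv (D - Finsupp.single (H.incl q) 1) F ∧ ∀ p ∈ F.support, r.point p ≠ x := by
  -- This divisor has degree `d`, so its rank is not positive; `q` below is a point witnessing the
  -- failure.
  have h1 : ¬ H.toMetricGraph.RankGE (r.push D - Finsupp.single x 1) 1 := fun h =>
    hd ⟨_, by rw [deg_sub, deg_single, deg_push, hdeg, add_sub_cancel_right], h⟩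
  rw [rankGE_one_iff] at h1 hD
  push Not at h1
  obtain ⟨q, hq⟩ := h1
  obtain ⟨F, hF, h⟩ := hD (H.incl q)
  refine ⟨q, F, hF, h, ?_⟩
  -- A point of `F` over `x` would make `r.push F` minus `x` effective, and it is equivalent to the
  -- divisor ruled out by the choice of `q`.
  by_contra! hx
  obtain ⟨p, hp, hpx⟩ := hx
  have h2 : r.push F x ≠ 0 := fun h0 => r.point_ne_of_push_eq_zero hF h0 hp hpx
  refine hq (r.push F - Finsupp.single x 1) ?_ ?_
  · classical
    intro y
    rw [Finsupp.sub_apply, Finsupp.single_apply]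
    have h3 := r.push_nonneg hF y
    rw [Finsupp.zero_apply] at h3 ⊢
    split_ifs with hy
    · subst hy
      omega
    · omega
  · obtain ⟨f, hf, hfd⟩ := r.push_linEquiv h
    refine ⟨f, hf, fun y => ?_⟩
    have := hfd y
    rw [push_sub, push_single_incl] at this
    simp only [Finsupp.sub_apply] at this ⊢
    rw [this]
    ring

end Retraction

/-! ### Walks -/

theorem Joins.symm {e : Γ.E} {a b : Γ.V} (h : Γ.Joins e a b) : Γ.Joins e b a := Or.symm h

theorem Walk.length_nonneg : ∀ {a b : Γ.V} (p : Γ.Walk a b), 0 ≤ p.length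
  | _, _, .nil _ => le_rfl
  | _, _, .cons e _ p => add_nonneg (Γ.len_pos e).le p.length_nonneg

theorem dist_le_length {a b : Γ.V} (p : Γ.Walk a b) : Γ.dist a b ≤ p.length :=
  ciInf_le ⟨0, by rintro _ ⟨q, rfl⟩; exact q.length_nonneg⟩ p

/-- A 1-Lipschitz potential certifies lower bounds for the path metric. -/
theorem Walk.sub_le_length {φ : Γ.V → ℝ} (hφ : ∀ e, |φ (Γ.src e) - φ (Γ.tgt e)| ≤ Γ.len e) :
    ∀ {a b : Γ.V} (p : Γ.Walk a b), φ b - φ a ≤ p.length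
  | _, _, .nil _ => by simp [Walk.length]
  | _, _, .cons e h p => by
    have h1 := p.sub_le_length hφ
    have h2 := abs_le.1 (hφ e)
    rw [Walk.length]
    rcases h with ⟨rfl, rfl⟩ | ⟨rfl, rfl⟩ <;> linarith

theorem sub_le_dist {φ : Γ.V → ℝ} (hφ : ∀ e, |φ (Γ.src e) - φ (Γ.tgt e)| ≤ Γ.len e) {a b : Γ.V}
    (p : Γ.Walk a b) : φ b - φ a ≤ Γ.dist a b :=
  -- The walk only supplies non-emptiness: the real infimum of an empty family is 0 by convention.
  have : Nonempty (Γ.Walk a b) := ⟨p⟩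
  le_ciInf fun q => q.sub_le_length hφ

/-- Edges of `H` are kept and all others are dropped, since their ends have the same image. -/
theorem Retraction.nonempty_walk {H : Γ.Subgraph} (r : Retraction H) :
    ∀ {a b : Γ.V}, Γ.Walk a b → Nonempty (H.toMetricGraph.Walk (r.toFun a) (r.toFun b))
  | _, _, .nil _ => ⟨.nil _⟩
  | _, _, .cons (b := b) e h p => by
    obtain ⟨q⟩ := r.nonempty_walk p
    by_cases he : e ∈ H.edges
    · have hs : r.toFun (Γ.src e) = H.toMetricGraph.src ⟨e, he⟩ :=
        r.apply_of_mem ⟨_, H.src_mem e he⟩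
      have ht : r.toFun (Γ.tgt e) = H.toMetricGraph.tgt ⟨e, he⟩ :=
        r.apply_of_mem ⟨_, H.tgt_mem e he⟩
      refine ⟨.cons ⟨e, he⟩ ?_ q⟩
      rcases h with ⟨rfl, rfl⟩ | ⟨rfl, rfl⟩
      · exact Or.inl ⟨hs.symm, ht.symm⟩
      · exact Or.inr ⟨hs.symm, ht.symm⟩
    · have h1 := r.src_eq_tgt e he
      rcases h with ⟨rfl, rfl⟩ | ⟨rfl, rfl⟩
      · rw [h1]
        exact ⟨q⟩
      · rw [← h1]
        exact ⟨q⟩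

theorem Retraction.connected {H : Γ.Subgraph} (r : Retraction H) (h : Γ.Connected) :
    H.toMetricGraph.Connected := by
  refine ⟨h.1.map r.toFun, fun a b => ?_⟩
  obtain ⟨p⟩ := h.2 a.1 b.1
  have := r.nonempty_walk p
  rwa [r.apply_of_mem a, r.apply_of_mem b] at this

/-! ### Cycles -/

/-- A periodic parametrisation of a cycle by the natural numbers. -/
structure CycleParam (C : Γ.Subgraph) where
  period : ℕ
  period_pos : 0 < period
  a : ℕ → Γ.V
  e : ℕ → Γ.E
  joins : ∀ m, Γ.Joins (e m) (a m) (a (m + 1))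
  a_add : ∀ m, a (m + period) = a m
  e_add : ∀ m, e (m + period) = e m
  a_inj : ∀ m < period, ∀ m' < period, a m = a m' → m = m'
  e_inj : ∀ m < period, ∀ m' < period, e m = e m' → m = m'
  mem_verts : ∀ b ∈ C.verts, ∃ m < period, a m = b
  mem_edges : ∀ b ∈ C.edges, ∃ m < period, e m = b
  e_mem : ∀ m, e m ∈ C.edges

theorem Subgraph.IsCycle.nonempty_cycleParam {C : Γ.Subgraph} (h : C.IsCycle) :
    Nonempty (CycleParam C) := by
  obtain ⟨k, a, e, ha, he, hav, hev, hj⟩ := h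
  have hval : ∀ {m}, m < k + 1 → (Fin.ofNat (k + 1) m).val = m := fun h => Nat.mod_eq_of_lt h
  have hinj : ∀ m < k + 1, ∀ m' < k + 1, Fin.ofNat (k + 1) m = Fin.ofNat (k + 1) m' → m = m' := by
    intro m hm m' hm' h
    rw [← hval hm, h, hval hm']
  have hsurj : ∀ i : Fin (k + 1), Fin.ofNat (k + 1) i = i := fun i => Fin.ext (hval i.2)
  have hper : ∀ m, Fin.ofNat (k + 1) (m + (k + 1)) = Fin.ofNat (k + 1) m := fun m =>
    Fin.ext (Nat.add_mod_right m (k + 1))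
  have hsucc : ∀ m, Fin.ofNat (k + 1) (m + 1) = Fin.ofNat (k + 1) m + 1 := by
    intro m
    apply Fin.ext
    simp [Fin.val_add]
  refine ⟨⟨k + 1, k.succ_pos, fun m => a (Fin.ofNat (k + 1) m), fun m => e (Fin.ofNat (k + 1) m),
    fun m => ?_, fun m => by rw [hper], fun m => by rw [hper],
    fun m hm m' hm' h => hinj m hm m' hm' (ha h), fun m hm m' hm' h => hinj m hm m' hm' (he h),
    ?_, ?_, fun m => hev ▸ Set.mem_range_self _⟩⟩
  · rw [hsucc]
    exact hj _
  · rw [← hav]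
    rintro _ ⟨i, rfl⟩
    exact ⟨i, i.2, by rw [hsurj]⟩
  · rw [← hev]
    rintro _ ⟨i, rfl⟩
    exact ⟨i, i.2, by rw [hsurj]⟩

namespace CycleParam

variable {C : Γ.Subgraph} (c : CycleParam C)

/-- The length of the first `m` edges. -/
noncomputable def pos (m : ℕ) : ℝ := ∑ j ∈ Finset.range m, Γ.len (c.e j)

/-- The length of the cycle. -/
noncomputable def total : ℝ := c.pos c.period

theorem pos_zero : c.pos 0 = 0 := rfl

theorem pos_succ (m : ℕ) : c.pos (m + 1) = c.pos m + Γ.len (c.e m) := Finset.sum_range_succ _ _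

theorem pos_strictMono : StrictMono c.pos := strictMono_nat_of_lt_succ fun m => by
  rw [pos_succ]
  linarith [Γ.len_pos (c.e m)]

theorem pos_nonneg (m : ℕ) : 0 ≤ c.pos m := c.pos_strictMono.monotone m.zero_le

theorem pos_add_period (m : ℕ) : c.pos (m + c.period) = c.pos m + c.total := by
  induction m with
  | zero => rw [Nat.zero_add, pos_zero, zero_add, total]
  | succ m ih =>
    rw [Nat.add_right_comm, pos_succ, ih, pos_succ, c.e_add]
    ring

theorem total_pos : 0 < c.total := c.pos_strictMono c.period_pos

theorem pos_lt_total {m : ℕ} (hm : m < c.period) : c.pos m < c.total := c.pos_strictMono hm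

theorem exists_walk (d : ℕ) : ∀ m, ∃ p : Γ.Walk (c.a m) (c.a (m + d)),
    p.length = c.pos (m + d) - c.pos m := by
  induction d with
  | zero => exact fun m => ⟨.nil _, by simp [Walk.length]⟩
  | succ d ih =>
    intro m
    obtain ⟨p, hp⟩ := ih (m + 1)
    rw [← Nat.add_assoc, Nat.add_right_comm]
    refine ⟨.cons (c.e m) (c.joins m) p, ?_⟩
    rw [Walk.length, hp, c.pos_succ m]
    ring

theorem exists_walk_symm (m d : ℕ) : ∃ p : Γ.Walk (c.a (m + d)) (c.a m),
    p.length = c.pos (m + d) - c.pos m := by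
  induction d with
  | zero => exact ⟨.nil _, by simp [Walk.length]⟩
  | succ d ih =>
    obtain ⟨p, hp⟩ := ih
    refine ⟨.cons (c.e (m + d)) (c.joins (m + d)).symm p, ?_⟩
    rw [Walk.length, hp, ← Nat.add_assoc, c.pos_succ]
    ring

/-- These are the two arcs of the cycle. The complementary one runs between the larger index and the
smaller index shifted by one period, which is the same vertex. -/
theorem exists_walk_length_eq {m m' : ℕ} (hm : m < c.period) (hm' : m' < c.period) :
    (∃ p : Γ.Walk (c.a m) (c.a m'), p.length = |c.pos m - c.pos m'|) ∧
      ∃ p : Γ.Walk (c.a m) (c.a m'), p.length = c.total - |c.pos m - c.pos m'| := by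
  rcases le_total m m' with h | h
  · have hle := c.pos_strictMono.monotone h
    have hp := c.exists_walk (m' - m) m
    have hq := c.exists_walk_symm m' (m + c.period - m')
    rw [Nat.add_sub_cancel' h] at hp
    rw [Nat.add_sub_cancel' (by omega), c.pos_add_period, c.a_add] at hq
    obtain ⟨p, hp⟩ := hp
    obtain ⟨q, hq⟩ := hq
    rw [abs_of_nonpos (by linarith)]
    exact ⟨⟨p, by linarith⟩, q, by linarith⟩
  · have hle := c.pos_strictMono.monotone h
    have hp := c.exists_walk_symm m' (m - m')
    have hq := c.exists_walk (m' + c.period - m) m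
    rw [Nat.add_sub_cancel' h] at hp
    rw [Nat.add_sub_cancel' (by omega), c.pos_add_period, c.a_add] at hq
    obtain ⟨p, hp⟩ := hp
    obtain ⟨q, hq⟩ := hq
    rw [abs_of_nonneg (by linarith)]
    exact ⟨⟨p, by linarith⟩, q, by linarith⟩

/-- A function on the vertices of the graph which restricts to the position on the cycle, and is
constant along the edges outside of the cycle. -/
structure IsPosition (Ψ : Γ.V → ℝ) : Prop where
  apply_a : ∀ m < c.period, Ψ (c.a m) = c.pos m
  src_eq_tgt : ∀ e ∉ C.edges, Ψ (Γ.src e) = Ψ (Γ.tgt e)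

theorem exists_isPosition (r : Retraction C) :
    ∃ Ψ : C.verts → ℝ, c.IsPosition fun b => Ψ (r.toFun b) := by
  choose idx h1 h2 using fun b : C.verts => c.mem_verts b b.2
  refine ⟨fun b => c.pos (idx b), fun m hm => ?_, fun e he => by rw [r.src_eq_tgt e he]⟩
  have hmem : c.a m ∈ C.verts := by
    rcases c.joins m with h | h
    · exact h.1 ▸ C.src_mem _ (c.e_mem m)
    · exact h.2 ▸ C.tgt_mem _ (c.e_mem m)
  have h3 : r.toFun (c.a m) = ⟨c.a m, hmem⟩ := r.apply_of_mem ⟨c.a m, hmem⟩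
  simp only [h3]
  rw [c.a_inj _ (h1 ⟨c.a m, hmem⟩) m hm (h2 ⟨c.a m, hmem⟩)]

variable {c}

/-- Along the cycle the position increases by the length of the edge, except at the last edge where
it drops by the total length. -/
theorem IsPosition.apply_succ {Ψ : Γ.V → ℝ} (hΨ : c.IsPosition Ψ) {m : ℕ} (hm : m < c.period) :
    Ψ (c.a (m + 1)) = c.pos (m + 1) ∨
      Ψ (c.a (m + 1)) = 0 ∧ c.pos (m + 1) = c.total := by
  rcases Nat.lt_or_ge (m + 1) c.period with h | h
  · exact Or.inl (hΨ.apply_a _ h)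
  · have h1 : m + 1 = 0 + c.period := by omega
    right
    rw [h1, c.a_add, hΨ.apply_a 0 c.period_pos, c.pos_add_period, pos_zero, zero_add]
    exact ⟨rfl, rfl⟩

/-- The two arcs give the upper bound. For the lower bound, the circular distance from `c.a m`,
composed with the position, is a 1-Lipschitz potential: off the cycle it does not vary along edges,
so detours through the components do not help. -/
theorem IsPosition.dist_eq {Ψ : Γ.V → ℝ} (hΨ : c.IsPosition Ψ) {m m' : ℕ} (hm : m < c.period)
    (hm' : m' < c.period) : Γ.dist (c.a m) (c.a m') =
      min |c.pos m - c.pos m'| (c.total - |c.pos m - c.pos m'|) := by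
  obtain ⟨⟨p, hp⟩, q, hq⟩ := c.exists_walk_length_eq hm hm'
  refine le_antisymm (le_min (hp ▸ dist_le_length p) (hq ▸ dist_le_length q)) ?_
  set g : ℝ → ℝ := fun y => min |c.pos m - y| (c.total - |c.pos m - y|) with hg
  have hlip : ∀ y z, |g y - g z| ≤ |y - z| := by
    intro y z
    refine (abs_min_sub_min_le_max _ _ _ _).trans (max_le ?_ ?_)
    · refine (abs_abs_sub_abs_le_abs_sub _ _).trans_eq ?_
      rw [sub_sub_sub_cancel_left, abs_sub_comm]
    · rw [sub_sub_sub_cancel_left]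
      refine (abs_abs_sub_abs_le_abs_sub _ _).trans_eq ?_
      rw [sub_sub_sub_cancel_left]
  -- Needed at the last edge, where the position drops to 0 instead of reaching `c.total`.
  have hper : g 0 = g c.total := by
    have h1 := c.pos_nonneg m
    have h2 := c.pos_lt_total hm
    simp only [hg]
    rw [sub_zero, abs_of_nonneg h1, abs_of_nonpos (by linarith), min_comm]
    congr 1 <;> ring
  have hφ : ∀ e, |g (Ψ (Γ.src e)) - g (Ψ (Γ.tgt e))| ≤ Γ.len e := by
    intro e
    by_cases he : e ∈ C.edges
    · obtain ⟨j, hj, rfl⟩ := c.mem_edges e he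
      have h1 : g (Ψ (c.a (j + 1))) = g (c.pos (j + 1)) := by
        rcases hΨ.apply_succ hj with h | ⟨h, h'⟩
        · rw [h]
        · rw [h, h', hper]
      have h2 : |g (Ψ (c.a j)) - g (Ψ (c.a (j + 1)))| ≤ Γ.len (c.e j) := by
        rw [h1, hΨ.apply_a j hj]
        refine (hlip _ _).trans_eq ?_
        rw [c.pos_succ, abs_sub_comm, add_sub_cancel_left, abs_of_pos (Γ.len_pos _)]
      rcases c.joins j with ⟨hs, ht⟩ | ⟨hs, ht⟩
      · rwa [hs, ht]
      · rwa [hs, ht, abs_sub_comm]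
    · rw [hΨ.src_eq_tgt e he, sub_self, abs_zero]
      exact (Γ.len_pos e).le
  have h := sub_le_dist (φ := fun b => g (Ψ b)) hφ p
  have h0 : g (c.pos m) = 0 := by
    simp only [hg]
    rw [sub_self, abs_zero, sub_zero, min_eq_left c.total_pos.le]
  simp only [hΨ.apply_a m hm, hΨ.apply_a m' hm', h0, sub_zero] at h
  exact h

/-! ### The Abel–Jacobi sum over the cycle. -/

/-- Extension of a function on the vertices to the points, constant on half-open edges. -/
def extend (Ψ : Γ.V → ℝ) : Γ.Point → ℝ
  | Sum.inl b => Ψ b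
  | Sum.inr ⟨e, _⟩ => Ψ (Γ.src e)

/-- The Abel–Jacobi sum over the cycle of a principal divisor is a period. -/
theorem IsPosition.exists_linearCombination_eq {Ψ : Γ.V → ℝ} (hΨ : c.IsPosition Ψ)
    {f : Γ.Point → ℝ} (hf : Γ.IsRational f) {G : Γ.Divisor} (hG : ∀ p, G p = Γ.ord f p)
    (hC : ∀ e ∈ C.edges, ∀ t, G (Sum.inr ⟨e, t⟩) = 0) :
    ∃ n : ℤ, Finsupp.linearCombination ℤ (extend Ψ) G = n * c.total := by
  classical
  -- Each edge contributes minus the increment of `f`, up to a multiple of the total length; the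
  -- increments telescope around the cycle.
  have key : ∀ m < c.period, ∃ n : ℤ, edgeTerm f G (extend Ψ) (c.e m) =
      n * c.total - (f (Sum.inl (c.a (m + 1))) - f (Sum.inl (c.a m))) := by
    intro m hm
    have hb : bends G (c.e m) = 0 := by
      ext t
      exact hC _ (c.e_mem m) t
    have hS : ∀ t : Set.Ioo (0 : ℝ) (Γ.len (c.e m)),
        Γ.slope f (c.e m) t 1 + Γ.slope f (c.e m) t (-1) = 0 := fun t =>
      (hG (Sum.inr ⟨c.e m, t⟩)).symm.trans (hC _ (c.e_mem m) t)
    have h1 := hf.sub_eq_slope_mul (c.e m) hS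
    have h2 : Γ.slope f (c.e m) (Γ.len (c.e m)) (-1) = -Γ.slope f (c.e m) 0 1 := by
      have := hf.slope_add_slope_add_sum (c.e m) 0 fun t => (hS t).symm
      rw [Finsupp.sum_zero_index] at this
      linarith
    have h3 : edgeTerm f G (extend Ψ) (c.e m) =
        Γ.slope f (c.e m) 0 1 * (Ψ (Γ.src (c.e m)) - Ψ (Γ.tgt (c.e m))) := by
      rw [edgeTerm, hb, Finsupp.sum_zero_index, h2, zsmul_eq_mul, zsmul_eq_mul]
      simp only [extend]
      push_cast
      ring
    -- Here `s` is the slope in the direction of travel, whichever way the edge is oriented.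
    obtain ⟨s, hs1, hs2⟩ : ∃ s : ℤ,
        edgeTerm f G (extend Ψ) (c.e m) = s * (Ψ (c.a m) - Ψ (c.a (m + 1))) ∧
        f (Sum.inl (c.a (m + 1))) - f (Sum.inl (c.a m)) = s * Γ.len (c.e m) := by
      rcases c.joins m with ⟨hs, ht⟩ | ⟨hs, ht⟩
      · rw [hs, ht] at h1 h3
        exact ⟨_, h3, h1⟩
      · rw [hs, ht] at h1 h3
        refine ⟨-Γ.slope f (c.e m) 0 1, ?_, ?_⟩
        · rw [h3]
          push_cast
          ring
        · push_cast
          linarith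
    rw [hs1, hs2, hΨ.apply_a m hm]
    rcases hΨ.apply_succ hm with h | ⟨h, h'⟩
    · refine ⟨0, ?_⟩
      rw [h, c.pos_succ]
      push_cast
      ring
    -- The drop of the position at the last edge is the only source of a non-zero period.
    · refine ⟨s, ?_⟩
      rw [h, ← h', c.pos_succ]
      ring
  choose! n hn using key
  refine ⟨∑ m ∈ Finset.range c.period, n m, ?_⟩
  rw [linearCombination_eq_sum_edgeTerm hG,
    ← Finset.sum_subset (Finset.subset_univ ((Finset.range c.period).image c.e))]
  · rw [Finset.sum_image fun m hm m' hm' h =>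
      c.e_inj m (Finset.mem_range.1 hm) m' (Finset.mem_range.1 hm') h]
    rw [Finset.sum_congr rfl fun m hm => hn m (Finset.mem_range.1 hm), Finset.sum_sub_distrib,
      Finset.sum_range_sub (fun m => f (Sum.inl (c.a m))), ← Finset.sum_mul]
    have h := c.a_add 0
    rw [Nat.zero_add] at h
    rw [h, sub_self, sub_zero]
    push_cast
    ring
  · intro e _ he
    have he : e ∉ C.edges := by
      intro h
      obtain ⟨m, hm, rfl⟩ := c.mem_edges e h
      exact he (Finset.mem_image_of_mem _ (Finset.mem_range.2 hm))
    exact edgeTerm_eq_zero hf hG rfl (hΨ.src_eq_tgt e he).symm fun _ => rfl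

end CycleParam

/-! ### Necklaces -/

namespace NecklaceDecomposition

variable (N : Γ.NecklaceDecomposition)

theorem x_mem (i : Fin N.n) : N.x i ∈ N.cycle.verts ∩ (N.component i).verts := by
  rw [N.verts_inter i]
  exact Set.mem_singleton _

theorem x_mem_component (i : Fin N.n) : N.x i ∈ (N.component i).verts := (N.x_mem i).2

theorem x_mem_cycle (i : Fin N.n) : N.x i ∈ N.cycle.verts := (N.x_mem i).1

theorem eq_x {i : Fin N.n} {a : Γ.V} (h : a ∈ N.cycle.verts) (h' : a ∈ (N.component i).verts) :
    a = N.x i := by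
  have : a ∈ N.cycle.verts ∩ (N.component i).verts := ⟨h, h'⟩
  rwa [N.verts_inter i] at this

theorem eq_of_mem {i j : Fin N.n} {a : Γ.V} (h : a ∈ (N.component i).verts)
    (h' : a ∈ (N.component j).verts) : i = j := by
  by_contra hij
  exact Set.disjoint_left.1 (N.disjoint i j hij) h h'

theorem x_injective : Function.Injective N.x := fun i j h =>
  N.eq_of_mem (N.x_mem_component i) (h ▸ N.x_mem_component j)

theorem mem_cycle_or_mem_component_edges (e : Γ.E) :
    e ∈ N.cycle.edges ∨ ∃ i, e ∈ (N.component i).edges := by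
  have h : e ∈ N.cycle.edges ∪ ⋃ i, (N.component i).edges := N.edges_cover ▸ Set.mem_univ e
  simpa using h

theorem notMem_component_edges {e : Γ.E} (he : e ∈ N.cycle.edges) (i : Fin N.n) :
    e ∉ (N.component i).edges := fun h =>
  Set.notMem_empty e (N.edges_inter i ▸ ⟨he, h⟩)

/-- A vertex of a component at which an edge outside of it ends is the attaching vertex. -/
theorem eq_x_of_notMem_edges {i : Fin N.n} {e : Γ.E} (he : e ∉ (N.component i).edges) {a : Γ.V}
    (ha : Γ.src e = a ∨ Γ.tgt e = a) (h : a ∈ (N.component i).verts) : a = N.x i := by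
  rcases N.mem_cycle_or_mem_component_edges e with he' | ⟨j, he'⟩
  · refine N.eq_x ?_ h
    rcases ha with rfl | rfl
    · exact N.cycle.src_mem e he'
    · exact N.cycle.tgt_mem e he'
  · have h' : a ∈ (N.component j).verts := by
      rcases ha with rfl | rfl
      · exact (N.component j).src_mem e he'
      · exact (N.component j).tgt_mem e he'
    obtain rfl := N.eq_of_mem h h'
    exact absurd he' he

open Classical in
/-- The retraction onto a component, which contracts the rest to the attaching vertex. -/
noncomputable def retraction (i : Fin N.n) : Retraction (N.component i) where
  toFun a := if h : a ∈ (N.component i).verts then ⟨a, h⟩ else ⟨N.x i, N.x_mem_component i⟩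
  apply_of_mem a := dif_pos a.2
  src_eq_tgt e he := by
    have h : ∀ a, (Γ.src e = a ∨ Γ.tgt e = a) →
        (if h : a ∈ (N.component i).verts then (⟨a, h⟩ : (N.component i).verts)
          else ⟨N.x i, N.x_mem_component i⟩) = ⟨N.x i, N.x_mem_component i⟩ := by
      intro a ha
      split_ifs with h
      · exact Subtype.ext (N.eq_x_of_notMem_edges he ha h)
      · rfl
    rw [h _ (Or.inl rfl), h _ (Or.inr rfl)]

theorem retraction_of_notMem {i : Fin N.n} {a : Γ.V} (h : a ∉ (N.component i).verts) :
    (N.retraction i).toFun a = ⟨N.x i, N.x_mem_component i⟩ := dif_neg h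

/-- Whatever lies outside the component is sent to the attaching vertex, so avoiding its fibre means
lying inside. -/
theorem mem_range_incl {i : Fin N.n} {p : Γ.Point}
    (h : (N.retraction i).point p ≠ Sum.inl ⟨N.x i, N.x_mem_component i⟩) :
    p ∈ Set.range (N.component i).incl := by
  rcases p with a | ⟨e, t⟩
  · by_cases ha : a ∈ (N.component i).verts
    · exact ⟨Sum.inl ⟨a, ha⟩, rfl⟩
    · exact absurd (congrArg Sum.inl (N.retraction_of_notMem ha)) h
  · by_cases he : e ∈ (N.component i).edges
    · exact ⟨Sum.inr ⟨⟨e, he⟩, t⟩, rfl⟩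
    · rw [Retraction.point_inr_of_notMem _ he] at h
      refine absurd (congrArg Sum.inl ?_) h
      by_cases ha : Γ.src e ∈ (N.component i).verts
      · rw [N.eq_x_of_notMem_edges he (Or.inl rfl) ha]
        exact (N.retraction i).apply_of_mem ⟨N.x i, N.x_mem_component i⟩
      · exact N.retraction_of_notMem ha

/-- Collapsing every component to its attaching vertex lets positions on the cycle extend to all
vertices, constantly on each component. -/
theorem exists_retraction_cycle : ∃ r : Retraction N.cycle,
    ∀ i, ∀ a ∈ (N.component i).verts, (r.toFun a : Γ.V) = N.x i := by
  have h : ∀ a, ∃ b : N.cycle.verts, (a ∈ N.cycle.verts → a = b) ∧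
      ∀ i, a ∈ (N.component i).verts → (b : Γ.V) = N.x i := by
    intro a
    by_cases ha : a ∈ N.cycle.verts
    · exact ⟨⟨a, ha⟩, fun _ => rfl, fun i hi => N.eq_x ha hi⟩
    · have h : a ∈ N.cycle.verts ∪ ⋃ i, (N.component i).verts := N.verts_cover ▸ Set.mem_univ a
      obtain ⟨i, hi⟩ := Set.mem_iUnion.1 (h.resolve_left ha)
      refine ⟨⟨N.x i, N.x_mem_cycle i⟩, fun h => absurd h ha, fun j hj => ?_⟩
      rw [N.eq_of_mem hi hj]
  choose r h1 h2 using h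
  refine ⟨⟨r, fun a => (Subtype.ext (h1 a a.2)).symm, fun e he => ?_⟩, fun i a ha => h2 a i ha⟩
  obtain ⟨i, hi⟩ := (N.mem_cycle_or_mem_component_edges e).resolve_left he
  apply Subtype.ext
  rw [h2 _ i ((N.component i).src_mem e hi), h2 _ i ((N.component i).tgt_mem e hi)]

/-- If a component is not hyperelliptic, a divisor of degree three and positive rank can be moved
into it. -/
theorem exists_linEquiv_component {i : Fin N.n}
    (hi : ¬ (N.component i).toMetricGraph.Hyperelliptic) {D : Γ.Divisor} (hD : D ∈ Γ.W 3 1) :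
    ∃ A : Γ.Divisor, Γ.LinEquiv D A ∧ ∀ p ∈ A.support, p ∈ Set.range (N.component i).incl := by
  classical
  obtain ⟨q, F, -, ⟨f, hf, hF⟩, hsupp⟩ := (N.retraction i).exists_effective_away hi
    (D := D) (by rw [hD.1]; norm_num) hD.2 (Sum.inl ⟨N.x i, N.x_mem_component i⟩)
  refine ⟨F + Finsupp.single ((N.component i).incl q) 1, ⟨f, hf, fun p => ?_⟩, fun p hp => ?_⟩
  · rw [Finsupp.add_apply, hF, Finsupp.sub_apply]
    ring
  · rcases Finset.mem_union.1 (Finsupp.support_add hp) with h | h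
    · exact N.mem_range_incl (hsupp p h)
    · rw [Finset.mem_singleton.1 (Finsupp.support_single_subset h)]
      exact ⟨q, rfl⟩

/-- The cycle sees a divisor supported in a component as its degree times the attaching vertex. -/
theorem linearCombination_extend {Ψ : Γ.V → ℝ} {i : Fin N.n}
    (hΨ : ∀ a ∈ (N.component i).verts, Ψ a = Ψ (N.x i)) {A : Γ.Divisor}
    (hA : ∀ p ∈ A.support, p ∈ Set.range (N.component i).incl) :
    Finsupp.linearCombination ℤ (CycleParam.extend Ψ) A = Γ.deg A * Ψ (N.x i) := by
  rw [Finsupp.linearCombination_apply, deg, Finsupp.sum, Finsupp.sum, Int.cast_sum,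
    Finset.sum_mul]
  refine Finset.sum_congr rfl fun p hp => ?_
  obtain ⟨q, rfl⟩ := hA p hp
  rw [zsmul_eq_mul]
  congr 1
  rcases q with a | ⟨e, t⟩
  · exact hΨ a.1 a.2
  · exact hΨ _ ((N.component i).src_mem e.1 e.2)

theorem apply_eq_zero_of_mem_cycle {i : Fin N.n} {A : Γ.Divisor}
    (hA : ∀ p ∈ A.support, p ∈ Set.range (N.component i).incl) {e : Γ.E} (he : e ∈ N.cycle.edges)
    (t : Set.Ioo (0 : ℝ) (Γ.len e)) : A (Sum.inr ⟨e, t⟩) = 0 := by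
  by_contra h
  obtain ⟨a | ⟨e', s⟩, hq⟩ := hA _ (Finsupp.mem_support_iff.2 h)
  · exact Sum.inl_ne_inr hq
  · have h1 : e'.1 = e := (Sigma.mk.inj (Sum.inr.inj hq)).1
    exact N.notMem_component_edges he i (h1 ▸ e'.2)

/-- Three times the distance of two attaching vertices along the cycle is a multiple of its
length. -/
theorem exists_three_mul_sub {c : CycleParam N.cycle} {Ψ : Γ.V → ℝ} (hΨ : c.IsPosition Ψ)
    (hΨ' : ∀ i, ∀ a ∈ (N.component i).verts, Ψ a = Ψ (N.x i)) {D : Γ.Divisor} (hD : D ∈ Γ.W 3 1)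
    (hN : ∀ i, ¬ (N.component i).toMetricGraph.Hyperelliptic) (i j : Fin N.n) :
    ∃ n : ℤ, 3 * (Ψ (N.x i) - Ψ (N.x j)) = n * c.total := by
  obtain ⟨A, hA, hAs⟩ := N.exists_linEquiv_component (hN i) hD
  obtain ⟨B, hB, hBs⟩ := N.exists_linEquiv_component (hN j) hD
  have hAd := hA.deg_eq
  have hBd := hB.deg_eq
  obtain ⟨f, hf, hAf⟩ := hA
  obtain ⟨g, hg, hBg⟩ := hB
  -- A - B is the divisor of `f - g` and has no point inside an edge of the cycle, so its
  -- Abel–Jacobi sum is a period.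
  obtain ⟨n, hn⟩ := hΨ.exists_linearCombination_eq (hf.sub hg) (G := A - B)
    (fun p => by
      rw [hf.ord_sub hg, Finsupp.sub_apply, hAf, hBg]
      ring)
    (fun e he t => by
      rw [Finsupp.sub_apply, N.apply_eq_zero_of_mem_cycle hAs he,
        N.apply_eq_zero_of_mem_cycle hBs he, sub_zero])
  refine ⟨n, ?_⟩
  rw [← hn, map_sub, N.linearCombination_extend (hΨ' i) hAs,
    N.linearCombination_extend (hΨ' j) hBs, hAd, hBd, hD.1]
  push_cast
  ring

end NecklaceDecomposition

/-! ### Points on a circle congruent modulo a third of its length. -/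

/-- Points of `[0, L)` which are congruent modulo `L / 3` but distinct are at most three. -/
theorem le_three_of_three_mul_sub {n : ℕ} {y : Fin n → ℝ} {L : ℝ} (hy : Function.Injective y)
    (h0 : ∀ i, 0 ≤ y i) (hL : ∀ i, y i < L)
    (h : ∀ i j, ∃ k : ℤ, 3 * (y i - y j) = k * L) : n ≤ 3 := by
  rcases Nat.eq_zero_or_pos n with rfl | hn
  · exact Nat.zero_le 3
  have hLpos : 0 < L := (h0 ⟨0, hn⟩).trans_lt (hL ⟨0, hn⟩)
  choose k hk using fun i => h i ⟨0, hn⟩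
  -- Equal residues modulo 3 make two points differ by a multiple of `L`; within `[0, L)` they
  -- coincide.
  have hinj : Function.Injective fun i => (k i : ZMod 3) := by
    intro i j hij
    obtain ⟨d, hd⟩ := (ZMod.intCast_eq_intCast_iff_dvd_sub (k i) (k j) 3).1 hij
    have h1 : y j - y i = d * L := by
      have h2 : (k j : ℝ) - k i = 3 * d := by exact_mod_cast hd
      have h3 : 3 * (y j - y i) = 3 * (d * L) := by
        rw [← mul_assoc, ← h2, sub_mul, ← hk, ← hk]
        ring
      linarith
    have h4 : d = 0 := by
      have h5 : (d : ℝ) < 1 := by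
        by_contra! h6
        nlinarith [h0 i, hL j]
      have h7 : (-1 : ℝ) < d := by
        by_contra! h6
        nlinarith [h0 j, hL i]
      have h8 : d < 1 := by exact_mod_cast h5
      have h9 : -1 < d := by exact_mod_cast h7
      omega
    rw [h4, Int.cast_zero, zero_mul, sub_eq_zero] at h1
    exact hy h1.symm
  simpa using Fintype.card_le_of_injective _ hinj

/-- Only k = ±1 or ±2 are possible, so the two arcs have lengths L/3 and 2L/3 in some order. -/
theorem min_abs_eq_third {y z L : ℝ} (hne : y ≠ z) (hy0 : 0 ≤ y) (hz0 : 0 ≤ z) (hy : y < L)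
    (hz : z < L) {k : ℤ} (h : 3 * (y - z) = k * L) :
    min |y - z| (L - |y - z|) = L / 3 := by
  have h1 : k < 3 := by
    have : (k : ℝ) < 3 := by
      by_contra! h6
      nlinarith
    exact_mod_cast this
  have h2 : -3 < k := by
    have : (-3 : ℝ) < k := by
      by_contra! h6
      nlinarith
    exact_mod_cast this
  have h3 : k ≠ 0 := by
    rintro rfl
    apply hne
    rw [Int.cast_zero, zero_mul] at h
    linarith
  have hL : 0 < L := hy0.trans_lt hy
  obtain rfl | rfl | rfl | rfl : k = 1 ∨ k = 2 ∨ k = -1 ∨ k = -2 := by omega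
  · rw [show y - z = L / 3 by push_cast at h; linarith, abs_of_pos (by linarith),
      min_eq_left (by linarith)]
  · rw [show y - z = 2 * L / 3 by push_cast at h; linarith, abs_of_pos (by linarith),
      min_eq_right (by linarith)]
    ring
  · rw [show y - z = -(L / 3) by push_cast at h; linarith, abs_neg, abs_of_pos (by linarith),
      min_eq_left (by linarith)]
  · rw [show y - z = -(2 * L / 3) by push_cast at h; linarith, abs_neg, abs_of_pos (by linarith),
      min_eq_right (by linarith)]
    ring

end MetricGraph

/-! ### Conclusion for necklaces. -/

theorem mainTheorem7 (Γ : MetricGraph.{u, v}) (hconn : Γ.Connected)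
    (htrig : Γ.DivisoriallyTrigonal) (N : Γ.NecklaceDecomposition)
    (hN : ∀ i, ¬ (N.component i).toMetricGraph.Hyperelliptic) :
    N.n = 3 ∧
      (∀ i, (N.component i).toMetricGraph.Connected ∧
        (N.component i).toMetricGraph.DivisoriallyTrigonal) ∧
      ∀ i j k l, i ≠ j → k ≠ l → Γ.dist (N.x i) (N.x j) = Γ.dist (N.x k) (N.x l) := by
  obtain ⟨D, hD⟩ := htrig
  obtain ⟨c⟩ := N.isCycle.nonempty_cycleParam
  obtain ⟨r, hr⟩ := N.exists_retraction_cycle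
  obtain ⟨Ψ₀, hΨ⟩ := c.exists_isPosition r
  set Ψ : Γ.V → ℝ := fun b => Ψ₀ (r.toFun b) with hΨdef
  have hΨ' : ∀ i, ∀ a ∈ (N.component i).verts, Ψ a = Ψ (N.x i) := by
    intro i a ha
    refine congrArg Ψ₀ (Subtype.ext ?_)
    rw [hr i a ha, hr i _ (N.x_mem_component i)]
  have hmul := N.exists_three_mul_sub hΨ hΨ' hD hN
  choose m hm hmx using fun i => c.mem_verts (N.x i) (N.x_mem_cycle i)
  have hpos : ∀ i, Ψ (N.x i) = c.pos (m i) := fun i => by rw [← hmx i, hΨ.apply_a _ (hm i)]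
  simp only [hpos] at hmul
  have hinj : Function.Injective fun i => c.pos (m i) := by
    intro i j h
    apply N.x_injective
    rw [← hmx i, ← hmx j, c.pos_strictMono.injective h]
  -- All pairwise distances equal one common value, a third of the length of the cycle.
  have hdist : ∀ i j, i ≠ j → Γ.dist (N.x i) (N.x j) = c.total / 3 := by
    intro i j hij
    obtain ⟨k, hk⟩ := hmul i j
    rw [← hmx i, ← hmx j, hΨ.dist_eq (hm i) (hm j)]
    exact MetricGraph.min_abs_eq_third (hinj.ne hij) (c.pos_nonneg _) (c.pos_nonneg _)
      (c.pos_lt_total (hm i)) (c.pos_lt_total (hm j)) hk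
  refine ⟨le_antisymm ?_ N.three_le, fun i => ⟨(N.retraction i).connected hconn, ?_⟩, ?_⟩
  · exact MetricGraph.le_three_of_three_mul_sub hinj (fun i => c.pos_nonneg _)
      (fun i => c.pos_lt_total (hm i)) hmul
  · exact ⟨(N.retraction i).push D, by rw [MetricGraph.Retraction.deg_push, hD.1],
      (N.retraction i).rankGE_one_push hD.2⟩
  · intro i j k l hij hkl
    rw [hdist i j hij, hdist k l hkl]
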